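/- Let $E$ be a real Banach lattice with the positive Schur property, i.e. every weakly null sequence $(x_n)$ in $E$ with $x_n\ge 0$ for all $n$ satisfies $\|x_n\|\to 0$, and let $T:E\to E$ be a bounded linear operator. Then $T$ is uo-demi Dunford–Pettis if and only if $T$ is un-demi Dunford–Pettis. Here a sequence $(x_n)$ in $E$ is order null if there is a net $(z_\gamma)$ in $E$ with $z_\gamma\downarrow 0$ such that for every $\gamma$ there is $n_0$ with $|x_n|\le z_\gamma$ for all $n\ge n_0$; it is uo-null if $(|x_n|\wedge y)_n$ is order null for every $y\in E^+$; and it is un-null if $\||x_n|\wedge y\|\to 0$ for every $y\in E^+$. The operator $T$ is uo-demi Dunford–Pettis if, for every weakly null sequence $(x_n)$ in $E$ such that $(x_n-Tx_n)$ is uo-null, one has $\|x_n\|\to 0$. The operator $T$ is un-demi Dunford–Pettis if, for every weakly null sequence $(x_n)$ in $E$ such that $(x_n-Tx_n)$ is un-null, the sequence $(x_n)$ is un-null. -/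

import Mathlib

/-!
In a Banach lattice with the positive Schur property, a weakly null sequence `x` is norm null as
soon as it is un-null. By Kadec–Pełczyński, some subsequence of `x` is norm asymptotic to a
pairwise disjoint sequence `y`, which is again weakly null. Disjointness gives
`‖∑ cᵢ |yᵢ|‖ = ‖∑ cᵢ yᵢ‖`, so by Hahn–Banach every functional on the `|yᵢ|` is the restriction of a
functional on the `yᵢ`; hence `|yᵢ|` is weakly null, and the positive Schur property makes it norm
null.

The two kinds of demi Dunford–Pettis operators are then compared through norm convergence: the
positive Schur property makes the norm order continuous, so that uo-null sequences are un-null, and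
every norm null sequence has a subsequence dominated by the tails of a convergent series, which is
uo-null.
-/

open Filter Topology

namespace BanachLattice

universe u

/-- The sequence `x` converges weakly to `0`. -/
def WeaklyNull {E : Type u} [NormedAddCommGroup E] [NormedSpace ℝ E] (x : ℕ → E) : Prop :=
  ∀ f : StrongDual ℝ E, Tendsto (fun n => f (x n)) atTop (𝓝 0)

/-- The sequence `x` order converges to `a`: there is a net `z`, indexed by some nonempty directed
set `Γ`, that decreases to `0` (it is decreasing with infimum `0`) and such that for every `γ` one
has `|x n - a| ≤ z γ` for all large `n`. The range of `z` lies in `E`, so index sets in the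
universe of `E` suffice. -/
def OrderConverges {E : Type u} [AddCommGroup E] [Lattice E] (x : ℕ → E) (a : E) : Prop :=
  ∃ (Γ : Type u) (_ : Preorder Γ) (_ : Nonempty Γ) (_ : IsDirected Γ (· ≤ ·)) (z : Γ → E),
    Antitone z ∧ IsGLB (Set.range z) 0 ∧
      ∀ γ : Γ, ∃ n₀ : ℕ, ∀ n, n₀ ≤ n → |x n - a| ≤ z γ

/-- Unbounded order convergence: `|x n - a| ⊓ y` order converges to `0` for every `y ≥ 0`. -/
def UOConverges {E : Type u} [AddCommGroup E] [Lattice E] (x : ℕ → E) (a : E) : Prop :=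
  ∀ y : E, 0 ≤ y → OrderConverges (fun n => |x n - a| ⊓ y) 0

/-- Unbounded norm convergence: `|x n - a| ⊓ y` tends to `0` in norm for every `y ≥ 0`. -/
def UNConverges {E : Type u} [NormedAddCommGroup E] [Lattice E] (x : ℕ → E) (a : E) : Prop :=
  ∀ y : E, 0 ≤ y → Tendsto (fun n => ‖|x n - a| ⊓ y‖) atTop (𝓝 0)

/-- The positive Schur property: weakly null sequences with positive terms are norm null. -/
def PositiveSchur (E : Type u) [NormedAddCommGroup E] [NormedSpace ℝ E] [Lattice E] : Prop :=
  ∀ x : ℕ → E, (∀ n, 0 ≤ x n) → WeaklyNull x → Tendsto (fun n => ‖x n‖) atTop (𝓝 0)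

/-- uo-demi Dunford–Pettis operators. -/
def UODemiDunfordPettis {E : Type u} [NormedAddCommGroup E] [NormedSpace ℝ E] [Lattice E]
    (T : E →L[ℝ] E) : Prop :=
  ∀ x : ℕ → E, WeaklyNull x → UOConverges (fun n => x n - T (x n)) 0 →
    Tendsto (fun n => ‖x n‖) atTop (𝓝 0)

/-- un-demi Dunford–Pettis operators. -/
def UNDemiDunfordPettis {E : Type u} [NormedAddCommGroup E] [NormedSpace ℝ E] [Lattice E]
    (T : E →L[ℝ] E) : Prop :=
  ∀ x : ℕ → E, WeaklyNull x → UNConverges (fun n => x n - T (x n)) 0 → UNConverges x 0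

end BanachLattice

namespace BanachLattice

section OrderedGroup

variable {E : Type*} [AddCommGroup E] [Lattice E]

/-- Two elements of a lattice ordered group are disjoint when the infimum of their moduli is `0`.
Mathlib's `Disjoint` does not apply, since a nontrivial ordered group has no least element. -/
def LatticeDisjoint (a b : E) : Prop :=
  |a| ⊓ |b| = 0

/-- The part of `x` that exceeds `w` in modulus, obtained by subtracting from `x` its truncation to
the order interval `[-w, w]`. Excesses over large enough elements turn an almost disjoint sequence
into a disjoint one. -/
def excess (w x : E) : E :=
  x - ((x ⊓ w) ⊔ -w)

variable [IsOrderedAddMonoid E]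

lemma latticeDisjoint_of_inf_le_zero {a b : E} (h : |a| ⊓ |b| ≤ 0) : LatticeDisjoint a b :=
  h.antisymm (le_inf (abs_nonneg a) (abs_nonneg b))

lemma inf_add_le_inf_add_inf {a b c : E} (ha : 0 ≤ a) (hb : 0 ≤ b) (hc : 0 ≤ c) :
    a ⊓ (b + c) ≤ a ⊓ b + a ⊓ c := by
  rw [add_inf, inf_add, inf_add]
  refine le_inf (le_inf ?_ ?_) (le_inf ?_ ?_)
  · exact inf_le_left.trans (le_add_of_nonneg_right ha)
  · exact inf_le_left.trans (le_add_of_nonneg_left hb)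
  · exact inf_le_left.trans (le_add_of_nonneg_right hc)
  · exact inf_le_right

lemma LatticeDisjoint.add_right {a b c : E} (hb : LatticeDisjoint a b) (hc : LatticeDisjoint a c) :
    LatticeDisjoint a (b + c) := by
  refine latticeDisjoint_of_inf_le_zero ?_
  calc |a| ⊓ |b + c| ≤ |a| ⊓ (|b| + |c|) := inf_le_inf_left _ (abs_add_le b c)
    _ ≤ |a| ⊓ |b| + |a| ⊓ |c| :=
        inf_add_le_inf_add_inf (abs_nonneg a) (abs_nonneg b) (abs_nonneg c)
    _ = 0 := by rw [hb, hc, add_zero]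

lemma LatticeDisjoint.sum_right {ι : Type*} {a : E} {u : ι → E} {s : Finset ι}
    (h : ∀ i ∈ s, LatticeDisjoint a (u i)) : LatticeDisjoint a (∑ i ∈ s, u i) :=
  Finset.sum_induction u (LatticeDisjoint a) (fun _ _ => LatticeDisjoint.add_right)
    (by simp [LatticeDisjoint]) h

lemma LatticeDisjoint.abs_add {a b : E} (h : LatticeDisjoint a b) : |a + b| = |a| + |b| := by
  refine (abs_add_le a b).antisymm ?_
  calc |a| + |b| = |a| ⊔ |b| - |a| ⊓ |b| := by rw [← inf_add_sup, h, zero_add, sub_zero]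
    _ = |(|a| - |-b|)| := by rw [sup_sub_inf_eq_abs_sub, abs_sub_comm, abs_neg]
    _ ≤ |a + b| := by simpa only [sub_neg_eq_add] using abs_abs_sub_abs_le a (-b)

lemma abs_sum_of_pairwise_latticeDisjoint {ι : Type*} {u : ι → E}
    (h : Pairwise fun i j => LatticeDisjoint (u i) (u j)) (s : Finset ι) :
    |∑ i ∈ s, u i| = ∑ i ∈ s, |u i| := by
  classical
  induction s using Finset.induction_on with
  | empty => simp
  | insert i s hi ih =>
    have hdisj : LatticeDisjoint (u i) (∑ j ∈ s, u j) :=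
      .sum_right fun j hj => h (ne_of_mem_of_not_mem hj hi).symm
    rw [Finset.sum_insert hi, Finset.sum_insert hi, hdisj.abs_add, ih]

lemma abs_sum_le_sum_abs {ι : Type*} (u : ι → E) (s : Finset ι) :
    |∑ i ∈ s, u i| ≤ ∑ i ∈ s, |u i| :=
  Finset.le_sum_of_subadditive _ abs_zero.le abs_add_le s u

lemma abs_sub_excess_le {w : E} (hw : 0 ≤ w) (x : E) : |x - excess w x| ≤ w := by
  rw [excess, sub_sub_cancel, abs_le']
  exact ⟨sup_le inf_le_right (neg_le_self hw), neg_le.mp le_sup_right⟩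

lemma abs_excess_le (w x : E) : |excess w x| ≤ (|x| - w)⁺ := by
  rw [excess, abs_le', neg_sub, sub_sup, sub_inf, sup_sub, sub_self, sub_neg_eq_add, posPart_def,
    sup_comm _ (0 : E)]
  refine ⟨inf_le_left.trans (sup_le_sup_left (sub_le_sub_right (le_abs_self x) w) 0),
    sup_le_sup (sub_nonpos.mpr inf_le_left) ?_⟩
  rw [sub_eq_neg_add, ← sub_eq_add_neg]
  exact sub_le_sub_right (neg_le_abs x) w

lemma latticeDisjoint_excess {x y v w : E} (hv : |x| ⊓ |y| ≤ v) (hw : |x| ⊓ |y| ≤ w) :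
    LatticeDisjoint (excess v x) (excess w y) := by
  refine latticeDisjoint_of_inf_le_zero ?_
  have hx : |excess v x| ≤ |x| - |x| ⊓ |y| := (abs_excess_le v x).trans
    (sup_le (sub_le_sub_left hv _) (sub_nonneg.mpr inf_le_left))
  have hy : |excess w y| ≤ |y| - |x| ⊓ |y| := (abs_excess_le w y).trans
    (sup_le (sub_le_sub_left hw _) (sub_nonneg.mpr inf_le_right))
  exact (inf_le_inf hx hy).trans_eq (by rw [← inf_sub, sub_self])

lemma OrderConverges.uoConverges {x : ℕ → E} {a : E} (h : OrderConverges x a) :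
    UOConverges x a := fun y hy => by
  obtain ⟨Γ, _, _, _, z, hz, hinf, hx⟩ := h
  refine ⟨Γ, _, ‹_›, ‹_›, z, hz, hinf, fun γ => (hx γ).imp fun n₀ hn₀ n hn => ?_⟩
  rw [sub_zero, abs_of_nonneg (le_inf (abs_nonneg _) hy)]
  exact inf_le_left.trans (hn₀ n hn)

end OrderedGroup

section OrderedModule

variable {𝕜 E : Type*} [Field 𝕜] [LinearOrder 𝕜] [IsStrictOrderedRing 𝕜] [AddCommGroup E]
  [Module 𝕜 E] [Lattice E] [IsOrderedAddMonoid E] [IsOrderedModule 𝕜 E]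

lemma abs_smul (c : 𝕜) (a : E) : |c • a| = |c| • |a| := by
  have abs_smul_of_pos {d : 𝕜} (hd : 0 < d) : |d • a| = d • |a| := by
    have hsup := (OrderIso.smulRight (β := E) hd).map_sup a (-a)
    simp only [OrderIso.smulRight_apply, smul_neg] at hsup
    exact hsup.symm
  rcases lt_trichotomy c 0 with hc | rfl | hc
  · rw [abs_of_neg hc, ← abs_smul_of_pos (neg_pos.mpr hc), neg_smul, abs_neg]
  · simp
  · rw [abs_of_pos hc, abs_smul_of_pos hc]

lemma LatticeDisjoint.smul {a b : E} (h : LatticeDisjoint a b) (c d : 𝕜) :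
    LatticeDisjoint (c • a) (d • b) := by
  refine latticeDisjoint_of_inf_le_zero ?_
  obtain ⟨m, hm, hcm, hdm⟩ : ∃ m : 𝕜, 0 < m ∧ |c| ≤ m ∧ |d| ≤ m :=
    ⟨max (max |c| |d|) 1, lt_max_of_lt_right one_pos, by simp, by simp⟩
  calc |c • a| ⊓ |d • b| = (|c| • |a|) ⊓ (|d| • |b|) := by rw [abs_smul, abs_smul]
    _ ≤ (m • |a|) ⊓ (m • |b|) := inf_le_inf (smul_le_smul_of_nonneg_right hcm (abs_nonneg a))
        (smul_le_smul_of_nonneg_right hdm (abs_nonneg b))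
    _ = m • (|a| ⊓ |b|) := ((OrderIso.smulRight (β := E) hm).map_inf |a| |b|).symm
    _ = 0 := by rw [h, smul_zero]

lemma abs_sum_smul_of_pairwise_latticeDisjoint {ι : Type*} {y : ι → E}
    (hy : Pairwise fun i j => LatticeDisjoint (y i) (y j)) (c : ι → 𝕜) (s : Finset ι) :
    |∑ i ∈ s, c i • y i| = ∑ i ∈ s, |c i| • |y i| := by
  rw [abs_sum_of_pairwise_latticeDisjoint fun i j hij => (hy hij).smul (c i) (c j)]
  simp only [abs_smul]

end OrderedModule

section WeaklyNull

variable {E F : Type*} [NormedAddCommGroup E] [NormedSpace ℝ E] [NormedAddCommGroup F]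
  [NormedSpace ℝ F] {x y : ℕ → E}

lemma WeaklyNull.comp_tendsto (h : WeaklyNull x) {φ : ℕ → ℕ} (hφ : Tendsto φ atTop atTop) :
    WeaklyNull (x ∘ φ) :=
  fun f => (h f).comp hφ

lemma WeaklyNull.sub (hx : WeaklyNull x) (hy : WeaklyNull y) : WeaklyNull (x - y) := fun f => by
  simpa using (hx f).sub (hy f)

lemma WeaklyNull.map (hx : WeaklyNull x) (T : E →L[ℝ] F) : WeaklyNull (T ∘ x) :=
  fun f => hx (f.comp T)

lemma WeaklyNull.of_tendsto (h : Tendsto x atTop (𝓝 0)) : WeaklyNull x := fun f => by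
  simpa only [map_zero, Function.comp_def] using (f.continuous.tendsto 0).comp h

end WeaklyNull

section HahnBanach

lemma exists_dual_apply_eq_of_norm_linearCombination_le {𝕜 E ι : Type*} [RCLike 𝕜]
    [NormedAddCommGroup E] [NormedSpace 𝕜 E] {y : ι → E} {b : ι → 𝕜} {C : ℝ}
    (h : ∀ c : ι →₀ 𝕜,
      ‖Finsupp.linearCombination 𝕜 b c‖ ≤ C * ‖Finsupp.linearCombination 𝕜 y c‖) :
    ∃ g : StrongDual 𝕜 E, ∀ i, g (y i) = b i := by
  obtain ⟨g, hg, -⟩ := exists_extension_norm_eq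
    (LinearMap.range (Finsupp.linearCombination 𝕜 y))
    ((Finsupp.linearCombination 𝕜 b).compLeftInverse (Finsupp.linearCombination 𝕜 y))
  refine ⟨g, fun i => ?_⟩
  have hyi : Finsupp.linearCombination 𝕜 y (Finsupp.single i 1) = y i := by simp
  rw [hg ⟨y i, _, hyi⟩, LinearMap.compLeftInverse_apply_of_bdd _ _ ⟨C, h⟩ _ _ hyi]
  simp

variable {E ι : Type*} [NormedAddCommGroup E] [NormedSpace ℝ E] [Lattice E] [IsOrderedAddMonoid E]
  [IsOrderedModule ℝ E] [HasSolidNorm E]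

lemma norm_sum_smul_abs_le_of_pairwise_latticeDisjoint {y : ι → E}
    (hy : Pairwise fun i j => LatticeDisjoint (y i) (y j)) (c : ι → ℝ) (s : Finset ι) :
    ‖∑ i ∈ s, c i • |y i|‖ ≤ ‖∑ i ∈ s, c i • y i‖ := by
  refine norm_le_norm_of_abs_le_abs ?_
  rw [abs_sum_smul_of_pairwise_latticeDisjoint hy]
  simpa only [abs_smul, abs_abs] using abs_sum_le_sum_abs (fun i => c i • |y i|) s

lemma exists_dual_apply_eq_apply_abs {y : ι → E}
    (hy : Pairwise fun i j => LatticeDisjoint (y i) (y j)) (f : StrongDual ℝ E) :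
    ∃ g : StrongDual ℝ E, ∀ i, g (y i) = f |y i| := by
  refine exists_dual_apply_eq_of_norm_linearCombination_le (C := ‖f‖) fun c => ?_
  calc ‖Finsupp.linearCombination ℝ (fun i => f |y i|) c‖ = ‖f (∑ i ∈ c.support, c i • |y i|)‖ := by
        simp [Finsupp.linearCombination_apply, Finsupp.sum]
    _ ≤ ‖f‖ * ‖∑ i ∈ c.support, c i • |y i|‖ := f.le_opNorm _
    _ ≤ ‖f‖ * ‖Finsupp.linearCombination ℝ y c‖ := by
        gcongr
        exact norm_sum_smul_abs_le_of_pairwise_latticeDisjoint hy c c.support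

lemma WeaklyNull.abs_of_pairwise_latticeDisjoint {y : ℕ → E} (h : WeaklyNull y)
    (hy : Pairwise fun i j => LatticeDisjoint (y i) (y j)) : WeaklyNull fun i => |y i| :=
  fun f => by
    obtain ⟨g, hg⟩ := exists_dual_apply_eq_apply_abs hy f
    simpa only [hg] using h g

end HahnBanach

section UNConverges

lemma exists_strictMono_forall_lt_of_eventually {P : ℕ → ℕ → ℕ → Prop}
    (h : ∀ k m, ∀ᶠ n in atTop, P k m n) :
    ∃ φ : ℕ → ℕ, StrictMono φ ∧ ∀ i j, i < j → P j (φ i) (φ j) := by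
  have hnext (N : ℕ) : ∃ n, N < n ∧ ∀ k ≤ N + 1, ∀ m ≤ N, P k m n :=
    ((eventually_gt_atTop N).and <| (Set.finite_Iic (N + 1)).eventually_all.mpr fun k _ =>
      (Set.finite_Iic N).eventually_all.mpr fun m _ => h k m).exists
  choose next hlt hP using hnext
  let φ : ℕ → ℕ := fun n => next^[n] 0
  have hφ_succ (n : ℕ) : φ (n + 1) = next (φ n) := Function.iterate_succ_apply' next n 0
  have hφ : StrictMono φ := strictMono_nat_of_lt_succ fun n => by rw [hφ_succ]; exact hlt _
  refine ⟨φ, hφ, fun i j hij => ?_⟩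
  obtain ⟨j, rfl⟩ := Nat.exists_eq_add_one_of_ne_zero (Nat.ne_zero_of_lt hij)
  rw [hφ_succ]
  exact hP (φ j) (j + 1) (Nat.succ_le_succ hφ.le_apply) (φ i)
    (hφ.monotone (Nat.le_of_lt_succ hij))

variable {E : Type*} [NormedAddCommGroup E] [Lattice E]

lemma UNConverges.comp_tendsto {x : ℕ → E} {a : E} (h : UNConverges x a) {φ : ℕ → ℕ}
    (hφ : Tendsto φ atTop atTop) : UNConverges (x ∘ φ) a :=
  fun y hy => (h y hy).comp hφ

variable [IsOrderedAddMonoid E]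

lemma UNConverges.exists_subseq_norm_inf_lt {x : ℕ → E} (h : UNConverges x 0) {δ : ℕ → ℝ}
    (hδ : ∀ k, 0 < δ k) :
    ∃ φ : ℕ → ℕ, StrictMono φ ∧ ∀ i j, i < j → ‖|x (φ i)| ⊓ |x (φ j)|‖ < δ j :=
  exists_strictMono_forall_lt_of_eventually (P := fun k m n => ‖|x m| ⊓ |x n|‖ < δ k)
    fun k m => by
      simpa only [sub_zero, inf_comm] using
        (h |x m| (abs_nonneg _)).eventually_lt_const (hδ k)

variable [HasSolidNorm E]

lemma norm_le_norm_of_nonneg_of_le {a b : E} (ha : 0 ≤ a) (h : a ≤ b) : ‖a‖ ≤ ‖b‖ :=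
  norm_le_norm_of_abs_le_abs (abs_le_abs_of_nonneg ha h)

lemma UNConverges.of_tendsto {x : ℕ → E} {a : E} (h : Tendsto x atTop (𝓝 a)) :
    UNConverges x a := fun y hy => by
  refine squeeze_zero (fun _ => norm_nonneg _) (fun n => ?_)
    (tendsto_iff_norm_sub_tendsto_zero.mp h)
  rw [← norm_abs_eq_norm (x n - a)]
  exact norm_le_norm_of_nonneg_of_le (le_inf (abs_nonneg _) hy) inf_le_left

variable [CompleteSpace E]

lemma exists_pairwise_latticeDisjoint_norm_sub_le {ι : Type*} {x : ι → E} {ε : ι → ℝ}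
    (hε₀ : ∀ i, 0 ≤ ε i) (hε : Summable ε)
    (h : Pairwise fun i j => ‖|x i| ⊓ |x j|‖ ≤ ε i * ε j) :
    ∃ y : ι → E, (Pairwise fun i j => LatticeDisjoint (y i) (y j)) ∧
      ∀ i, ‖x i - y i‖ ≤ ε i * ∑' j, ε j := by
  let w : ι → E := fun i => ∑' j : {j // j ≠ i}, |x i| ⊓ |x j|
  have hbound (i : ι) (j : {j // j ≠ i}) : ‖|x i| ⊓ |x j|‖ ≤ ε i * ε j := h j.2.symm
  have hsum (i : ι) : Summable fun j : {j // j ≠ i} => ε i * ε j := (hε.subtype _).mul_left _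
  have hnonneg (i : ι) (j : {j // j ≠ i}) : 0 ≤ |x i| ⊓ |x j| :=
    le_inf (abs_nonneg _) (abs_nonneg _)
  have hle {i j : ι} (hij : i ≠ j) : |x i| ⊓ |x j| ≤ w i :=
    (Summable.of_norm_bounded (hsum i) (hbound i)).le_tsum ⟨j, hij.symm⟩ fun k _ => hnonneg i k
  have hw (i : ι) : ‖w i‖ ≤ ε i * ∑' j, ε j :=
    calc ‖w i‖ ≤ ∑' j : {j // j ≠ i}, ε i * ε j :=
          tsum_of_norm_bounded (hsum i).hasSum (hbound i)
      _ = ε i * ∑' j : {j // j ≠ i}, ε j := tsum_mul_left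
      _ ≤ ε i * ∑' j, ε j :=
          mul_le_mul_of_nonneg_left (hε.tsum_subtype_le ε _ hε₀) (hε₀ i)
  refine ⟨fun i => excess (w i) (x i), fun i j hij => ?_, fun i => ?_⟩
  · exact latticeDisjoint_excess (hle hij) ((inf_comm _ _).trans_le (hle hij.symm))
  · have habs : |x i - excess (w i) (x i)| ≤ w i := abs_sub_excess_le (tsum_nonneg (hnonneg i)) _
    exact (norm_le_norm_of_abs_le_abs (habs.trans (le_abs_self _))).trans (hw i)

lemma UNConverges.exists_subseq_pairwise_latticeDisjoint_approx {x : ℕ → E}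
    (h : UNConverges x 0) :
    ∃ (φ : ℕ → ℕ) (y : ℕ → E), StrictMono φ ∧
      (Pairwise fun i j => LatticeDisjoint (y i) (y j)) ∧
      Tendsto (x ∘ φ - y) atTop (𝓝 0) := by
  obtain ⟨φ, hφ, hlt⟩ := h.exists_subseq_norm_inf_lt (δ := fun j => (1 / 2) ^ j * (1 / 2) ^ j)
    fun j => by positivity
  have hle {i j : ℕ} (hij : i < j) :
      ‖|x (φ i)| ⊓ |x (φ j)|‖ ≤ (1 / 2) ^ i * (1 / 2) ^ j :=
    (hlt i j hij).le.trans <| mul_le_mul_of_nonneg_right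
      (pow_le_pow_of_le_one (by norm_num) (by norm_num) hij.le) (by positivity)
  have halmost : Pairwise fun i j => ‖|x (φ i)| ⊓ |x (φ j)|‖ ≤ (1 / 2) ^ i * (1 / 2) ^ j := by
    intro i j hij
    rcases hij.lt_or_gt with hij | hji
    · exact hle hij
    · simpa only [inf_comm, mul_comm] using hle hji
  obtain ⟨y, hy, hxy⟩ := exists_pairwise_latticeDisjoint_norm_sub_le (x := x ∘ φ)
    (fun i => by positivity) summable_geometric_two halmost
  refine ⟨φ, y, hφ, hy, squeeze_zero_norm hxy ?_⟩
  simpa only [zero_mul] using summable_geometric_two.tendsto_atTop_zero.mul_const _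

end UNConverges

section OrderContinuity

variable {E : Type*} [NormedAddCommGroup E] [NormedSpace ℝ E] [Lattice E] [IsOrderedAddMonoid E]
  [HasSolidNorm E]

lemma sum_abs_apply_le {ι : Type*} {w : ι → E} (hw : ∀ i, 0 ≤ w i) (f : StrongDual ℝ E)
    (s : Finset ι) : ∑ i ∈ s, |f (w i)| ≤ ‖f‖ * ‖∑ i ∈ s, w i‖ := by
  have hsign (i : ι) : ∃ u : E, |u| = w i ∧ f u = |f (w i)| := by
    rcases le_total 0 (f (w i)) with hf | hf
    · exact ⟨w i, abs_of_nonneg (hw i), (abs_of_nonneg hf).symm⟩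
    · exact ⟨-w i, by rw [abs_neg, abs_of_nonneg (hw i)], by rw [map_neg, abs_of_nonpos hf]⟩
  choose u hu hfu using hsign
  have habs : |∑ i ∈ s, u i| ≤ ∑ i ∈ s, w i := by
    simpa only [hu] using abs_sum_le_sum_abs u s
  calc ∑ i ∈ s, |f (w i)| = f (∑ i ∈ s, u i) := by simp only [map_sum, hfu]
    _ ≤ ‖f‖ * ‖∑ i ∈ s, u i‖ := (Real.le_norm_self _).trans (f.le_opNorm _)
    _ ≤ ‖f‖ * ‖∑ i ∈ s, w i‖ := by
        gcongr
        exact norm_le_norm_of_abs_le_abs (habs.trans (le_abs_self _))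

lemma WeaklyNull.of_sum_range_le {w : ℕ → E} {b : E} (hw : ∀ n, 0 ≤ w n)
    (hb : ∀ N, ∑ n ∈ Finset.range N, w n ≤ b) : WeaklyNull w := fun f => by
  have hs : Summable fun n => |f (w n)| := by
    refine summable_of_sum_range_le (c := ‖f‖ * ‖b‖) (fun _ => abs_nonneg _) fun N =>
      (sum_abs_apply_le hw f _).trans ?_
    gcongr
    exact norm_le_norm_of_nonneg_of_le (Finset.sum_nonneg fun n _ => hw n) (hb N)
  exact (tendsto_zero_iff_abs_tendsto_zero _).mpr hs.tendsto_atTop_zero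

variable {Γ : Type*} [Preorder Γ] {z : Γ → E}

lemma PositiveSchur.exists_forall_ge_norm_sub_lt [Nonempty Γ] (hE : PositiveSchur E)
    (hz : Antitone z) (hb : BddBelow (Set.range z)) {δ : ℝ} (hδ : 0 < δ) :
    ∃ γ, ∀ γ', γ ≤ γ' → ‖z γ - z γ'‖ < δ := by
  by_contra! hfar
  choose next hle hnext using hfar
  obtain ⟨b, hb⟩ := hb
  let g : ℕ → Γ := fun n => next^[n] (Classical.arbitrary Γ)
  have hg (n : ℕ) : g (n + 1) = next (g n) := Function.iterate_succ_apply' next n _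
  let w : ℕ → E := fun n => z (g n) - z (g (n + 1))
  have hw (n : ℕ) : 0 ≤ w n := sub_nonneg.mpr (hz (by rw [hg]; exact hle _))
  have hsum (N : ℕ) : ∑ n ∈ Finset.range N, w n ≤ z (g 0) - b := by
    rw [Finset.sum_range_sub' (fun n => z (g n))]
    exact sub_le_sub_left (hb ⟨_, rfl⟩) _
  obtain ⟨n, hn⟩ := ((hE w hw (.of_sum_range_le hw hsum)).eventually_lt_const hδ).exists
  exact hn.not_ge (by simpa only [w, hg] using hnext (g n))

variable [Nonempty Γ] [IsDirected Γ (· ≤ ·)]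

lemma PositiveSchur.cauchySeq_of_antitone (hE : PositiveSchur E) (hz : Antitone z)
    (hb : BddBelow (Set.range z)) : CauchySeq z := by
  refine Metric.cauchy_iff.mpr ⟨inferInstance, fun δ hδ => ?_⟩
  obtain ⟨γ, hγ⟩ := hE.exists_forall_ge_norm_sub_lt hz hb (half_pos hδ)
  refine ⟨z '' Set.Ici γ, image_mem_map (Ici_mem_atTop γ), ?_⟩
  rintro _ ⟨α, hα, rfl⟩ _ ⟨β, hβ, rfl⟩
  calc dist (z α) (z β) ≤ dist (z γ) (z α) + dist (z γ) (z β) := dist_triangle_left _ _ _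
    _ < δ / 2 + δ / 2 := by
        rw [dist_eq_norm, dist_eq_norm]
        exact add_lt_add (hγ α hα) (hγ β hβ)
    _ = δ := add_halves δ

variable [CompleteSpace E]

lemma PositiveSchur.tendsto_of_antitone_of_isGLB (hE : PositiveSchur E) (hz : Antitone z) {a : E}
    (ha : IsGLB (Set.range z) a) : Tendsto z atTop (𝓝 a) := by
  obtain ⟨l, hl⟩ := cauchySeq_tendsto_of_complete (hE.cauchySeq_of_antitone hz ⟨a, ha.1⟩)
  rwa [ha.unique (isGLB_of_tendsto_atTop hz hl)]

lemma PositiveSchur.tendsto_of_orderConverges (hE : PositiveSchur E) {x : ℕ → E} {a : E}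
    (h : OrderConverges x a) : Tendsto x atTop (𝓝 a) := by
  obtain ⟨Γ, _, _, _, z, hz, hinf, hx⟩ := h
  refine Metric.tendsto_atTop.mpr fun ε hε => ?_
  have hnorm : Tendsto (fun γ => ‖z γ‖) atTop (𝓝 0) :=
    tendsto_zero_iff_norm_tendsto_zero.mp (hE.tendsto_of_antitone_of_isGLB hz hinf)
  obtain ⟨γ, hγ⟩ := (hnorm.eventually_lt_const hε).exists
  obtain ⟨n₀, hn₀⟩ := hx γ
  refine ⟨n₀, fun n hn => ?_⟩
  rw [dist_eq_norm]
  exact (norm_le_norm_of_abs_le_abs ((hn₀ n hn).trans (le_abs_self _))).trans_lt hγ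

lemma PositiveSchur.unConverges_of_uoConverges (hE : PositiveSchur E) {x : ℕ → E} {a : E}
    (h : UOConverges x a) : UNConverges x a :=
  fun y hy =>
    have hlim : Tendsto (fun n => |x n - a| ⊓ y) atTop (𝓝 0) :=
      hE.tendsto_of_orderConverges (h y hy)
    tendsto_zero_iff_norm_tendsto_zero.mp hlim

end OrderContinuity

section OrderConvergentSubsequence

variable {E : Type*} [NormedAddCommGroup E] [Lattice E] [IsOrderedAddMonoid E] [HasSolidNorm E]
  {x : ℕ → E} {a : E}

lemma orderConverges_of_antitone_of_abs_sub_le {z : ℕ → E} (hz : Antitone z)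
    (hlim : Tendsto z atTop (𝓝 0)) (h : ∀ n, |x n - a| ≤ z n) : OrderConverges x a := by
  refine ⟨ULift ℕ, inferInstance, inferInstance, inferInstance, z ∘ ULift.down,
    fun _ _ hkl => hz hkl, ?_, fun k => ⟨k.down, fun n hn => (h n).trans (hz hn)⟩⟩
  rw [ULift.down_surjective.range_comp]
  exact isGLB_of_tendsto_atTop hz hlim

variable [CompleteSpace E]

lemma orderConverges_of_summable_norm_sub (h : Summable fun n => ‖x n - a‖) :
    OrderConverges x a := by
  have habs : Summable fun n => |x n - a| :=
    .of_norm (by simpa only [norm_abs_eq_norm] using h)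
  have hs (k : ℕ) : Summable fun n => |x (n + k) - a| :=
    habs.comp_injective (add_left_injective k)
  let tail : ℕ → E := fun k => ∑' n, |x (n + k) - a|
  have htail (k : ℕ) : tail k = |x k - a| + tail (k + 1) := by
    simpa only [tail, zero_add, add_assoc, add_comm 1 k] using (hs k).tsum_eq_zero_add
  have htail_nonneg (k : ℕ) : 0 ≤ tail k := tsum_nonneg fun _ => abs_nonneg _
  refine orderConverges_of_antitone_of_abs_sub_le (z := tail)
    (antitone_nat_of_succ_le fun k => ?_) (tendsto_sum_nat_add fun n => |x n - a|) fun k => ?_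
  · rw [htail k]
    exact le_add_of_nonneg_left (abs_nonneg _)
  · rw [htail k]
    exact le_add_of_nonneg_right (htail_nonneg _)

lemma exists_subseq_orderConverges_of_tendsto (h : Tendsto x atTop (𝓝 a)) :
    ∃ φ : ℕ → ℕ, StrictMono φ ∧ OrderConverges (x ∘ φ) a := by
  obtain ⟨φ, hφ, hle⟩ := extraction_forall_of_eventually fun k : ℕ =>
    (tendsto_iff_norm_sub_tendsto_zero.mp h).eventually_le_const
      (show (0 : ℝ) < (1 / 2) ^ k by positivity)
  exact ⟨φ, hφ, orderConverges_of_summable_norm_sub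
    (.of_nonneg_of_le (fun _ => norm_nonneg _) hle summable_geometric_two)⟩

end OrderConvergentSubsequence

lemma PositiveSchur.tendsto_zero_of_unConverges {E : Type*} [NormedAddCommGroup E]
    [NormedSpace ℝ E] [CompleteSpace E] [Lattice E] [IsOrderedAddMonoid E] [IsOrderedModule ℝ E]
    [HasSolidNorm E] (hE : PositiveSchur E) {x : ℕ → E} (hx : WeaklyNull x)
    (hu : UNConverges x 0) : Tendsto x atTop (𝓝 0) := by
  refine tendsto_of_subseq_tendsto fun ns hns => ?_
  obtain ⟨φ, y, hφ, hy, hxy⟩ :=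
    (hu.comp_tendsto hns).exists_subseq_pairwise_latticeDisjoint_approx
  have hy_weak : WeaklyNull y := by
    simpa only [sub_sub_cancel] using
      ((hx.comp_tendsto hns).comp_tendsto hφ.tendsto_atTop).sub (.of_tendsto hxy)
  have hy_norm : Tendsto y atTop (𝓝 0) := by
    simpa only [norm_abs_eq_norm, ← tendsto_zero_iff_norm_tendsto_zero] using
      hE _ (fun i => abs_nonneg (y i)) (hy_weak.abs_of_pairwise_latticeDisjoint hy)
  exact ⟨φ, by simpa using hxy.add hy_norm⟩

end BanachLattice

theorem mainTheorem1 {E : Type*} [NormedAddCommGroup E] [NormedSpace ℝ E] [CompleteSpace E]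
    [Lattice E] [IsOrderedAddMonoid E] [IsOrderedModule ℝ E] [HasSolidNorm E]
    (hE : BanachLattice.PositiveSchur E) (T : E →L[ℝ] E) :
    BanachLattice.UODemiDunfordPettis T ↔ BanachLattice.UNDemiDunfordPettis T := by
  constructor
  · intro hT x hx hu
    have hres : Tendsto (fun n => x n - T (x n)) atTop (𝓝 0) :=
      hE.tendsto_zero_of_unConverges (hx.sub (hx.map T)) hu
    refine .of_tendsto (tendsto_of_subseq_tendsto fun ns hns => ?_)
    obtain ⟨φ, hφ, ho⟩ :=
      BanachLattice.exists_subseq_orderConverges_of_tendsto (hres.comp hns)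
    have hsub : BanachLattice.WeaklyNull ((x ∘ ns) ∘ φ) :=
      (hx.comp_tendsto hns).comp_tendsto hφ.tendsto_atTop
    exact ⟨φ, tendsto_zero_iff_norm_tendsto_zero.mpr (hT _ hsub ho.uoConverges)⟩
  · intro hT x hx hu
    have hun : BanachLattice.UNConverges x 0 := hT x hx (hE.unConverges_of_uoConverges hu)
    exact tendsto_zero_iff_norm_tendsto_zero.mp (hE.tendsto_zero_of_unConverges hx hun)
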